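/- Let $n\ge 3$ be a prime. For an odd prime power $q$, let $\mathbb F_q$ be the finite field with $q$ elements, let $s(n,q)$ be the number of elements of $SL_2(\mathbb F_q)$ of the form $x^n$ with $x\in SL_2(\mathbb F_q)$, and let $c(n,q)$ be the number of conjugacy classes of $SL_2(\mathbb F_q)$ which contain such an element. Then $|SL_2(\mathbb F_q)|=(q-1)q(q+1)$ and, for every odd prime power $q$: 1. if $n\nmid |SL_2(\mathbb F_q)|$, then $c(n,q)=q+4$ and $s(n,q)=q^3-q$; 2. if $n\mid q$, then $c(n,q)=q$ and $s(n,q)=(q-2)(q^2-1)$; 3. if $n\mid q-1$, then $c(n,q)=\frac{(n+1)(q-1)}{2n}+5$ and $s(n,q)=\frac{(n+1)(q^3-q)}{2n}$; 4. if $n\mid q+1$, then $c(n,q)=\frac{(n+1)(q-3)+4}{2n}+5$ and $s(n,q)=\frac{(n+1)(q^3-q)}{2n}$. Moreover, as $q\to\infty$ through the odd prime powers with $n\nmid q$ and $n\mid |SL_2(\mathbb F_q)|$ (that is, with $n\mid q^2-1$), the proportion of conjugacy classes of $SL_2(\mathbb F_q)$ which are $n$-th powers (that is, which contain an $n$-th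 power), namely $c(n,q)$ divided by the number of conjugacy classes of $SL_2(\mathbb F_q)$, and the proportion $s(n,q)/|SL_2(\mathbb F_q)|$ of elements which are $n$-th powers both tend to $\frac{n+1}{2n}$. -/

import Mathlib

universe u

/-- A conjugacy class `C` of `G` is an `n`-th power if it is the class of an `n`-th power
(equivalently, some, or every, element of `C` has an `n`-th root in `G`). -/
def IsPowerClass {G : Type u} [Group G] (n : ℕ) (C : ConjClasses G) : Prop :=
  ∃ x : G, ConjClasses.mk (x ^ n) = C

/-- The number `c(n, q)` of conjugacy classes of `SL₂(F)` that are `n`-th powers. -/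
noncomputable def numPowerClasses (n : ℕ) (F : Type u) [Field F] : ℕ :=
  Set.ncard {C : ConjClasses (Matrix.SpecialLinearGroup (Fin 2) F) | IsPowerClass n C}

/-- The number `s(n, q)` of elements of `SL₂(F)` that are `n`-th powers. -/
noncomputable def numPowers (n : ℕ) (F : Type u) [Field F] : ℕ :=
  Set.ncard {g : Matrix.SpecialLinearGroup (Fin 2) F |
    ∃ x : Matrix.SpecialLinearGroup (Fin 2) F, x ^ n = g}

/-!
Away from the traces `±2`, a conjugacy class of `SL₂(F)` is determined by its trace `a + a⁻¹`, where
`a` lies in the split torus `a ^ (q - 1) = 1` or in the nonsplit torus `a ^ (q + 1) = 1`. An `n`-th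
power replaces `a` by `a ^ n`, so the traces of `n`-th powers come from the subgroups of index
`gcd (q ∓ 1, n)` of these two cyclic groups, which makes them easy to count; the number of elements
of a given trace `t` is read off the number of roots of `X ^ 2 - t X + 1`.

An element of trace `±2` has order dividing `2 p`, where `p` is the characteristic. So for `n` odd,
either `n` is prime to `p` and all these elements are `n`-th powers, or `p` divides `n` and only
`±1` are. The order and the class number of `SL₂(F)` are the case `n = 1` of the count.
-/

open Matrix Polynomial

open scoped MatrixGroups

section Generic

theorem ncard_preimage_eq_mul {α β : Type*} [Finite α] {f : α → β} {T : Set β}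
    (hT : T.Finite) {k : ℕ} (h : ∀ t ∈ T, {x | f x = t}.ncard = k) :
    {x | f x ∈ T}.ncard = T.ncard * k := by
  induction T, hT using Set.Finite.induction_on with
  | empty => simp
  | @insert t T ht hT ih =>
    have hsplit : {x | f x ∈ insert t T} = {x | f x = t} ∪ {x | f x ∈ T} := rfl
    have hdisj : Disjoint {x | f x = t} {x | f x ∈ T} :=
      Set.disjoint_left.2 fun x hx hxT => ht (hx ▸ hxT)
    rw [hsplit, Set.ncard_union_eq hdisj, ih fun s hs => h s (Set.mem_insert_of_mem t hs),
      h t (Set.mem_insert t T), Set.ncard_insert_of_notMem ht hT]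
    ring

theorem isSquare_mul_of_not_isSquare {G : Type*} [CommGroup G] [IsCyclic G] {a b : G}
    (ha : ¬IsSquare a) (hb : ¬IsSquare b) : IsSquare (a * b) := by
  obtain ⟨g, hg⟩ := IsCyclic.exists_generator (α := G)
  obtain ⟨i, rfl⟩ := Subgroup.mem_zpowers_iff.1 (hg a)
  obtain ⟨j, rfl⟩ := Subgroup.mem_zpowers_iff.1 (hg b)
  have odd_of {k : ℤ} (hk : ¬IsSquare (g ^ k)) : Odd k :=
    Int.not_even_iff_odd.1 fun h => hk (h.isSquare_zpow g)
  rw [← _root_.zpow_add]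
  exact ((odd_of ha).add_odd (odd_of hb)).isSquare_zpow g

theorem natCard_map_powMonoidHom {G : Type*} [CommGroup G] (H : Subgroup G) [IsCyclic H] [Finite H]
    (n : ℕ) : Nat.card (H.map (powMonoidHom n)) = Nat.card H / (Nat.card H).gcd n := by
  have h : H.map (powMonoidHom n) = (powMonoidHom n : H →* H).range.map H.subtype := by
    conv_lhs => rw [← H.range_subtype, MonoidHom.map_range]
    rw [MonoidHom.map_range]
    rfl
  rw [h, Subgroup.card_map_of_injective H.subtype_injective, IsCyclic.card_powMonoidHom_range]

theorem map_powMonoidHom_rootsOfUnity (M : Type*) [CommMonoid M] (N n : ℕ) [NeZero N]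
    [HasEnoughRootsOfUnity M N] :
    (rootsOfUnity N M).map (powMonoidHom n) = rootsOfUnity (N / N.gcd n) M := by
  have hdvd : N / N.gcd n ∣ N := Nat.div_dvd_of_dvd (Nat.gcd_dvd_left N n)
  have : NeZero (N / N.gcd n) := ⟨(Nat.div_gcd_pos_of_pos_left n (NeZero.pos N)).ne'⟩
  have : HasEnoughRootsOfUnity M (N / N.gcd n) := .of_dvd M hdvd
  refine Subgroup.eq_of_le_of_card_ge ?_ (le_of_eq ?_)
  · rintro _ ⟨a, ha, rfl⟩
    rw [mem_rootsOfUnity, powMonoidHom_apply, ← pow_mul]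
    refine (mem_rootsOfUnity _ _).1 (rootsOfUnity_le_of_dvd ?_ ha)
    rw [← Nat.mul_div_assoc n (Nat.gcd_dvd_left N n), Nat.mul_comm,
      Nat.mul_div_assoc N (Nat.gcd_dvd_right N n)]
    exact Nat.dvd_mul_right N _
  · rw [natCard_map_powMonoidHom, HasEnoughRootsOfUnity.natCard_rootsOfUnity,
      HasEnoughRootsOfUnity.natCard_rootsOfUnity]

theorem sq_eq_four_iff {R : Type*} [CommRing R] [IsDomain R] {t : R} :
    t ^ 2 = 4 ↔ t = 2 ∨ t = -2 := by
  rw [show (4 : R) = 2 ^ 2 by norm_num, sq_eq_sq_iff_eq_or_eq_neg]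

theorem exists_sq_eq_one_of_sq_eq_four {R : Type*} [CommRing R] [IsDomain R] {t : R}
    (ht : t ^ 2 = 4) : ∃ ε : R, ε ^ 2 = 1 ∧ t = 2 * ε := by
  rcases sq_eq_four_iff.1 ht with rfl | rfl
  · exact ⟨1, one_pow 2, (mul_one 2).symm⟩
  · exact ⟨-1, neg_one_sq, (mul_neg_one 2).symm⟩

end Generic

section FiniteFields

variable {F : Type*} [Field F]

theorem ringChar_ne_two [NeZero (2 : F)] : ringChar F ≠ 2 := fun h =>
  two_ne_zero (α := F) (by exact_mod_cast h ▸ ringChar.Nat.cast_ringChar (R := F))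

variable [Finite F]

theorem exists_quadraticForm_eq {a b c : F} (h : discrim a b c ≠ 0) (μ : F) :
    ∃ x y, a * x ^ 2 + b * x * y + c * y ^ 2 = μ := by
  have := Fintype.ofFinite F
  rw [discrim] at h
  rcases eq_or_ne a 0 with rfl | ha
  · have hb : b ≠ 0 := by
      rintro rfl
      simp at h
    exact ⟨(μ - c) / b, 1, by field_simp; ring⟩
  by_cases hF : ringChar F = 2
  · obtain ⟨x, hx⟩ := FiniteField.isSquare_of_char_two hF (μ / a)
    exact ⟨x, 0, by rw [sq, ← hx]; field_simp; ring⟩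
  have h2 : (2 : F) ≠ 0 := Ring.two_ne_zero hF
  -- Completing the square, `4 a` times the form is `X ^ 2 - discrim a b c * y ^ 2`.
  obtain ⟨X, y, hXy⟩ := FiniteField.exists_root_sum_quadratic
    (degree_quadratic (one_ne_zero (α := F)) (b := 0) (c := -(4 * a * μ)))
    (degree_quadratic (neg_ne_zero.2 h) (b := 0) (c := 0)) (FiniteField.odd_card_of_char_ne_two hF)
  simp only [eval_add, eval_mul, eval_C, eval_pow, eval_X] at hXy
  refine ⟨(X - b * y) / (2 * a), y, ?_⟩
  field_simp
  linear_combination hXy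

variable (F) in
theorem exists_unit_not_isSquare [NeZero (2 : F)] : ∃ δ : Fˣ, ¬IsSquare δ := by
  obtain ⟨d, hd⟩ := FiniteField.exists_nonsquare (ringChar_ne_two (F := F))
  have hd0 : d ≠ 0 := by
    rintro rfl
    exact hd IsSquare.zero
  exact ⟨Units.mk0 d hd0, fun h => hd (h.map (Units.coeHom F))⟩

theorem neZero_two_of_odd_natCard (h : Odd (Nat.card F)) : NeZero (2 : F) := by
  have := Fintype.ofFinite F
  rw [Nat.card_eq_fintype_card, Nat.odd_iff] at h
  refine ⟨Ring.two_ne_zero fun h2 => ?_⟩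
  rw [FiniteField.even_card_iff_char_two.1 h2] at h
  exact absurd h zero_ne_one

theorem mem_range_algebraMap_iff_pow_natCard {K : Type*} [Field K] [Algebra F K] {z : K} :
    z ∈ Set.range (algebraMap F K) ↔ z ^ Nat.card F = z := by
  have := Fintype.ofFinite F
  rw [Nat.card_eq_fintype_card]
  have hprod : (X ^ Fintype.card F - X : F[X]) = ∏ x : F, (X - C x) := by
    have hmonic : (X ^ Fintype.card F - X : F[X]).Monic :=
      monic_X_pow_sub (by rw [degree_X]; exact_mod_cast Fintype.one_lt_card)
    rw [← prod_multiset_X_sub_C_of_monic_of_roots_card_eq hmonic,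
      FiniteField.roots_X_pow_card_sub_X]
    · rfl
    · rw [FiniteField.roots_X_pow_card_sub_X,
        FiniteField.X_pow_card_sub_X_natDegree_eq F Fintype.one_lt_card]
      rfl
  have h := congrArg (aeval z) hprod
  simp only [map_sub, map_pow, map_prod, aeval_X, aeval_C] at h
  rw [← sub_eq_zero (b := z), h, Finset.prod_eq_zero_iff]
  exact ⟨fun ⟨x, hx⟩ => ⟨x, Finset.mem_univ x, sub_eq_zero.2 hx.symm⟩,
    fun ⟨x, _, hx⟩ => ⟨x, (sub_eq_zero.1 hx).symm⟩⟩

end FiniteFields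

section DiagTrace

variable {K : Type*} [Field K]

/-- The trace `a + a⁻¹` of the diagonal matrix `diag (a, a⁻¹)` of `SL₂`. -/
def diagTrace (a : Kˣ) : K := a + (a⁻¹ : Kˣ)

theorem mul_diagTrace_sub_eq_one_iff {a : Kˣ} {x : K} :
    x * (diagTrace a - x) = 1 ↔ x = a ∨ x = (a⁻¹ : Kˣ) := by
  have h : (x - a) * (x - (a⁻¹ : Kˣ)) = 1 - x * (diagTrace a - x) := by
    rw [diagTrace]
    linear_combination a.mul_inv
  rw [eq_comm, ← sub_eq_zero, ← h, mul_eq_zero, sub_eq_zero, sub_eq_zero]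

theorem diagTrace_eq_diagTrace_iff {a b : Kˣ} : diagTrace a = diagTrace b ↔ a = b ∨ a = b⁻¹ := by
  rw [Units.ext_iff, Units.ext_iff, ← mul_diagTrace_sub_eq_one_iff]
  have h : (a : K) * (diagTrace a - a) = 1 := by simp [diagTrace]
  rw [← h, mul_right_inj' a.ne_zero, sub_left_inj, eq_comm]

theorem diagTrace_sq_eq_four_iff {a : Kˣ} : diagTrace a ^ 2 = 4 ↔ a ^ 2 = 1 := by
  have h : diagTrace a ^ 2 - 4 = (a - (a⁻¹ : Kˣ) : K) ^ 2 := by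
    rw [diagTrace]
    linear_combination 4 * a.mul_inv
  rw [← sub_eq_zero, h, sq_eq_zero_iff, sub_eq_zero, Units.val_inj, eq_inv_iff_mul_eq_one, sq]

theorem diagTrace_pow (a : Kˣ) (n : ℕ) :
    diagTrace (a ^ n) = (dickson 1 1 n).eval (diagTrace a) := by
  rw [diagTrace, diagTrace, dickson_one_one_eval_add_inv _ _ a.mul_inv, ← inv_pow,
    Units.val_pow_eq_pow_val, Units.val_pow_eq_pow_val]

theorem map_diagTrace {L : Type*} [Field L] (f : K →+* L) (a : Kˣ) :
    f (diagTrace a) = diagTrace (Units.map (f : K →* L) a) := by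
  simp [diagTrace]

theorem exists_diagTrace_eq_of_mul_sub_eq_one {t x : K} (h : x * (t - x) = 1) :
    ∃ a : Kˣ, diagTrace a = t :=
  ⟨⟨x, t - x, h, by rw [mul_comm, h]⟩, add_sub_cancel x t⟩

theorem diagTrace_surjective [IsAlgClosed K] : Function.Surjective (diagTrace (K := K)) := by
  intro t
  obtain ⟨x, hx⟩ := IsAlgClosed.exists_root (C 1 * X ^ 2 + C (-t) * X + C 1 : K[X])
    (by rw [degree_quadratic one_ne_zero]; exact two_ne_zero)
  refine exists_diagTrace_eq_of_mul_sub_eq_one (x := x) ?_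
  simp only [IsRoot, eval_add, eval_mul, eval_C, eval_pow, eval_X] at hx
  linear_combination -hx

theorem ncard_roots_diagTrace {a : Kˣ} (ha : a ^ 2 ≠ 1) :
    {x | x * (diagTrace a - x) = 1}.ncard = 2 := by
  have hne : (a : K) ≠ (a⁻¹ : Kˣ) := by
    rwa [ne_eq, Units.val_inj, eq_inv_iff_mul_eq_one, ← sq]
  simp only [mul_diagTrace_sub_eq_one_iff]
  exact Set.ncard_pair hne

theorem ncard_roots_of_sq_eq_four {t : K} (ht : t ^ 2 = 4) : {x | x * (t - x) = 1}.ncard = 1 := by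
  obtain ⟨ε, hε, rfl⟩ : ∃ ε : Kˣ, ε⁻¹ = ε ∧ diagTrace ε = t := by
    rcases sq_eq_four_iff.1 ht with rfl | rfl
    · exact ⟨1, inv_one, by norm_num [diagTrace]⟩
    · exact ⟨-1, by simp, by norm_num [diagTrace]⟩
  simp only [mul_diagTrace_sub_eq_one_iff, hε, or_self]
  exact Set.ncard_singleton _

section Finite

variable {F : Type*} [Field F] [Finite F] [Algebra F K]

theorem diagTrace_pow_natCard (a : Kˣ) :
    diagTrace a ^ Nat.card F = diagTrace (a ^ Nat.card F) := by
  have := Fintype.ofFinite F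
  obtain ⟨p, _⟩ := CharP.exists F
  have := charP_of_injective_algebraMap (algebraMap F K).injective p
  obtain ⟨k, hp, hk⟩ := FiniteField.card F p
  have := Fact.mk hp
  simp only [diagTrace, Nat.card_eq_fintype_card, hk, add_pow_char_pow, ← inv_pow,
    Units.val_pow_eq_pow_val]

theorem diagTrace_mem_range_algebraMap_iff {a : Kˣ} :
    diagTrace a ∈ Set.range (algebraMap F K) ↔
      a ∈ rootsOfUnity (Nat.card F - 1) K ∨ a ∈ rootsOfUnity (Nat.card F + 1) K := by
  rw [mem_range_algebraMap_iff_pow_natCard, diagTrace_pow_natCard, diagTrace_eq_diagTrace_iff,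
    mem_rootsOfUnity, mem_rootsOfUnity, pow_succ, eq_inv_iff_mul_eq_one,
    ← pow_sub_one_mul Nat.card_pos.ne' a, mul_eq_right]

end Finite

theorem ncard_image_diagTrace [NeZero (2 : K)] (H : Subgroup Kˣ) [Finite H] (hH : -1 ∈ H) :
    2 * (diagTrace '' {a | a ∈ H ∧ a ^ 2 ≠ 1}).ncard + 2 = Nat.card H := by
  set T := diagTrace '' {a | a ∈ H ∧ a ^ 2 ≠ 1}
  have hregular : {a : H | diagTrace a.1 ∈ T} = {a : H | a.1 ^ 2 ≠ 1} := by
    ext a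
    refine ⟨?_, fun ha => ⟨a, ⟨a.2, ha⟩, rfl⟩⟩
    rintro ⟨b, ⟨-, hb⟩, hab⟩
    rw [Set.mem_ofPred_eq, ne_eq, ← diagTrace_sq_eq_four_iff, ← hab, diagTrace_sq_eq_four_iff]
    exact hb
  have hfibre : ∀ t ∈ T, {a : H | diagTrace a.1 = t}.ncard = 2 := by
    rintro _ ⟨b, ⟨hbH, hb⟩, rfl⟩
    have hne : (⟨b, hbH⟩ : H) ≠ ⟨b, hbH⟩⁻¹ := fun h =>
      hb (by rw [sq, ← eq_inv_iff_mul_eq_one]; exact congrArg Subtype.val h)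
    rw [← Set.ncard_pair hne]
    congr 1
    ext a
    simp [diagTrace_eq_diagTrace_iff, Subtype.ext_iff]
  have hT : T.Finite := (Set.toFinite (H : Set Kˣ)).subset (fun _ h => h.1) |>.image _
  have hcentral : {a : H | a.1 ^ 2 ≠ 1}ᶜ = {1, ⟨-1, hH⟩} := by
    ext a
    rw [Set.mem_compl_iff, Set.mem_ofPred_eq, not_not, Set.mem_insert_iff, Set.mem_singleton_iff,
      Subtype.ext_iff, Subtype.ext_iff, Units.ext_iff, Units.ext_iff, Units.ext_iff]
    exact sq_eq_one_iff
  have hne : (1 : H) ≠ ⟨-1, hH⟩ := fun h => two_ne_zero (α := K) <| by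
    have h : (1 : K) = -1 := congrArg (fun a : H => (a.1 : K)) h
    linear_combination h
  rw [← Set.ncard_add_ncard_compl {a : H | a.1 ^ 2 ≠ 1}, hcentral, ← hregular,
    ncard_preimage_eq_mul hT hfibre, Set.ncard_pair hne, mul_comm]

end DiagTrace

section TorusTraces

variable (F : Type*) [Field F]

/-- The elements `a + a⁻¹` of `F`, for `a ≠ ±1` an `m`-th root of unity in the algebraic closure.
For `m = q - 1` and `m = q + 1`, where `q` is the order of `F`, these are the traces of the
regular elements of the split and of the nonsplit tori of `SL₂(F)`. -/
def torusTraces (m : ℕ) : Set F :=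
  algebraMap F (AlgebraicClosure F) ⁻¹'
    (diagTrace '' {a | a ∈ rootsOfUnity m (AlgebraicClosure F) ∧ a ^ 2 ≠ 1})

variable {F}

theorem torusTraces_subset_of_dvd {m N : ℕ} (h : m ∣ N) : torusTraces F m ⊆ torusTraces F N :=
  Set.preimage_mono <| Set.image_mono fun _ ha => ⟨rootsOfUnity_le_of_dvd h ha.1, ha.2⟩

theorem sq_ne_four_of_mem_torusTraces {m : ℕ} {t : F} (ht : t ∈ torusTraces F m) : t ^ 2 ≠ 4 := by
  obtain ⟨a, ⟨-, ha⟩, hat⟩ := ht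
  intro h
  rw [ne_eq, ← diagTrace_sq_eq_four_iff, hat, ← map_pow, h, map_ofNat] at ha
  exact ha rfl

variable [Finite F]

theorem natCast_natCard_eq_zero (K : Type*) [Field K] [Algebra F K] : (Nat.card F : K) = 0 := by
  have := Fintype.ofFinite F
  rw [Nat.card_eq_fintype_card, ← map_natCast (algebraMap F K), Nat.cast_card_eq_zero, map_zero]

theorem neZero_natCast_of_dvd (K : Type*) [Field K] [Algebra F K] {m : ℕ}
    (hm : m ∣ Nat.card F - 1 ∨ m ∣ Nat.card F + 1) : NeZero (m : K) := by
  have hq : (Nat.card F : K) = 0 := natCast_natCard_eq_zero K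
  refine ⟨fun h => one_ne_zero (α := K) ?_⟩
  rcases hm with hm | hm <;> have := Nat.cast_dvd_cast (α := K) hm <;> rw [h, zero_dvd_iff] at this
  · rw [Nat.cast_sub Nat.card_pos, hq] at this
    simp at this
  · rw [Nat.cast_add, hq] at this
    simp at this

theorem disjoint_torusTraces :
    Disjoint (torusTraces F (Nat.card F - 1)) (torusTraces F (Nat.card F + 1)) := by
  refine Set.disjoint_left.2 ?_
  rintro t ⟨a, ⟨ha, ha2⟩, hat⟩ ⟨b, ⟨hb, -⟩, hbt⟩
  have hab : a ∈ rootsOfUnity (Nat.card F + 1) (AlgebraicClosure F) := by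
    rcases diagTrace_eq_diagTrace_iff.1 (hat.trans hbt.symm) with rfl | rfl
    · exact hb
    · exact inv_mem hb
  rw [mem_rootsOfUnity] at ha hab
  rw [← Nat.sub_add_cancel (Nat.card_pos (α := F)), add_assoc, pow_add, ha, one_mul] at hab
  exact ha2 hab

theorem torusTraces_natCard_sub_one :
    torusTraces F (Nat.card F - 1) = diagTrace '' {a : Fˣ | a ^ 2 ≠ 1} := by
  set f := algebraMap F (AlgebraicClosure F)
  have hrange {a : (AlgebraicClosure F)ˣ} :
      a ∈ rootsOfUnity (Nat.card F - 1) (AlgebraicClosure F) ↔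
        a ∈ Set.range (Units.map (f : F →* AlgebraicClosure F)) := by
    rw [mem_rootsOfUnity, ← mul_left_inj a, ← pow_succ, Nat.sub_add_cancel Nat.card_pos, one_mul,
      ← Units.val_inj, Units.val_pow_eq_pow_val, ← mem_range_algebraMap_iff_pow_natCard]
    constructor
    · rintro ⟨b, hb⟩
      have hb0 : b ≠ 0 := by
        rintro rfl
        exact a.ne_zero (by rw [← hb, map_zero])
      exact ⟨Units.mk0 b hb0, Units.ext hb⟩
    · rintro ⟨b, rfl⟩
      exact ⟨b, rfl⟩
  have hsq {a : Fˣ} : Units.map (f : F →* AlgebraicClosure F) a ^ 2 = 1 ↔ a ^ 2 = 1 := by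
    rw [← diagTrace_sq_eq_four_iff, ← map_diagTrace, ← map_pow, ← map_ofNat f, f.injective.eq_iff,
      diagTrace_sq_eq_four_iff]
  ext t
  constructor
  · rintro ⟨a, ⟨ha, ha2⟩, hat⟩
    obtain ⟨b, rfl⟩ := hrange.1 ha
    exact ⟨b, hsq.not.1 ha2, f.injective ((map_diagTrace f b).trans hat)⟩
  · rintro ⟨b, hb, rfl⟩
    exact ⟨_, ⟨hrange.2 ⟨b, rfl⟩, hsq.not.2 hb⟩, (map_diagTrace f b).symm⟩

theorem ncard_roots_of_mem_torusTraces_sub_one {t : F} (ht : t ∈ torusTraces F (Nat.card F - 1)) :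
    {x | x * (t - x) = 1}.ncard = 2 := by
  rw [torusTraces_natCard_sub_one] at ht
  obtain ⟨a, ha, rfl⟩ := ht
  exact ncard_roots_diagTrace ha

theorem ncard_roots_of_mem_torusTraces_add_one {t : F} (ht : t ∈ torusTraces F (Nat.card F + 1)) :
    {x | x * (t - x) = 1}.ncard = 0 := by
  rw [Set.ncard_eq_zero, Set.eq_empty_iff_forall_notMem]
  intro x hx
  obtain ⟨a, rfl⟩ := exists_diagTrace_eq_of_mul_sub_eq_one hx
  refine Set.disjoint_left.1 disjoint_torusTraces ?_ ht
  rw [torusTraces_natCard_sub_one]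
  exact ⟨a, diagTrace_sq_eq_four_iff.not.1 (sq_ne_four_of_mem_torusTraces ht), rfl⟩

theorem ncard_torusTraces [NeZero (2 : F)] {m : ℕ} (hm : m ∣ Nat.card F - 1 ∨ m ∣ Nat.card F + 1)
    (heven : Even m) : 2 * (torusTraces F m).ncard + 2 = m := by
  set K := AlgebraicClosure F
  have := neZero_natCast_of_dvd K hm
  have : NeZero m := .of_neZero_natCast K
  have : NeZero (2 : K) := ⟨by
    rw [← map_ofNat (algebraMap F K)]
    exact (_root_.map_ne_zero _).2 two_ne_zero⟩
  have hrange : diagTrace '' {a | a ∈ rootsOfUnity m K ∧ a ^ 2 ≠ 1} ⊆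
      Set.range (algebraMap F K) := by
    rintro _ ⟨a, ⟨ha, -⟩, rfl⟩
    exact diagTrace_mem_range_algebraMap_iff.2
      (hm.imp (fun h => rootsOfUnity_le_of_dvd h ha) fun h => rootsOfUnity_le_of_dvd h ha)
  rw [torusTraces, ← Set.ncard_image_of_injective _ (algebraMap F K).injective,
    Set.image_preimage_eq_of_subset hrange, ncard_image_diagTrace,
    HasEnoughRootsOfUnity.natCard_rootsOfUnity]
  rw [mem_rootsOfUnity, heven.neg_one_pow]

theorem mem_torusTraces_div_gcd_iff {N : ℕ} (hN : N = Nat.card F - 1 ∨ N = Nat.card F + 1) (n : ℕ)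
    {t : F} : t ∈ torusTraces F (N / N.gcd n) ↔
      t ^ 2 ≠ 4 ∧ ∃ a ∈ rootsOfUnity N (AlgebraicClosure F),
        diagTrace (a ^ n) = algebraMap F (AlgebraicClosure F) t := by
  have := neZero_natCast_of_dvd (AlgebraicClosure F) (hN.imp dvd_of_eq dvd_of_eq)
  have : NeZero N := .of_neZero_natCast (AlgebraicClosure F)
  constructor
  · intro ht
    have ht4 := sq_ne_four_of_mem_torusTraces ht
    obtain ⟨b, ⟨hb, -⟩, hbt⟩ := ht
    rw [← map_powMonoidHom_rootsOfUnity] at hb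
    obtain ⟨a, ha, rfl⟩ := hb
    exact ⟨ht4, a, ha, hbt⟩
  · rintro ⟨ht4, a, ha, hat⟩
    refine ⟨a ^ n, ⟨?_, fun h => ht4 ?_⟩, hat⟩
    · rw [← map_powMonoidHom_rootsOfUnity]
      exact ⟨a, ha, rfl⟩
    · refine (algebraMap F (AlgebraicClosure F)).injective ?_
      rw [map_pow, ← hat, map_ofNat]
      exact diagTrace_sq_eq_four_iff.2 h

theorem mem_range_dickson_eval_iff (n : ℕ) {t : F} :
    (∃ s, (dickson 1 1 n).eval s = t) ↔
      ∃ a : (AlgebraicClosure F)ˣ,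
        (a ∈ rootsOfUnity (Nat.card F - 1) _ ∨ a ∈ rootsOfUnity (Nat.card F + 1) _) ∧
          diagTrace (a ^ n) = algebraMap F (AlgebraicClosure F) t := by
  set f := algebraMap F (AlgebraicClosure F)
  have hf (s : F) : f ((dickson 1 1 n).eval s) = (dickson 1 1 n).eval (f s) := by
    rw [← eval_map_apply, map_dickson, map_one]
  simp only [← diagTrace_mem_range_algebraMap_iff, diagTrace_pow]
  constructor
  · rintro ⟨s, rfl⟩
    obtain ⟨a, ha⟩ := diagTrace_surjective (f s)
    exact ⟨a, ⟨s, ha.symm⟩, by rw [ha, hf]⟩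
  · rintro ⟨a, ⟨s, hs⟩, ha⟩
    exact ⟨s, f.injective (by rw [hf, hs, ha])⟩

theorem setOf_dickson_eval_of_sq_ne_four (n : ℕ) :
    {t : F | (∃ s, (dickson 1 1 n).eval s = t) ∧ t ^ 2 ≠ 4} =
      torusTraces F ((Nat.card F - 1) / (Nat.card F - 1).gcd n) ∪
        torusTraces F ((Nat.card F + 1) / (Nat.card F + 1).gcd n) := by
  ext t
  rw [Set.mem_union, mem_torusTraces_div_gcd_iff (.inl rfl), mem_torusTraces_div_gcd_iff (.inr rfl),
    ← and_or_left, ← exists_or, Set.mem_ofPred_eq, mem_range_dickson_eval_iff, and_comm]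
  simp only [or_and_right]

end TorusTraces

section Entries

variable {R : Type*} [CommRing R]

theorem trace_eq_of_isConj {g h : SL(2, R)} (H : IsConj g h) : g.1.trace = h.1.trace := by
  obtain ⟨c, rfl⟩ := isConj_iff.1 H
  rw [Matrix.SpecialLinearGroup.coe_mul, trace_mul_comm, ← Matrix.SpecialLinearGroup.coe_mul,
    inv_mul_cancel_left]

theorem det_entries (g : SL(2, R)) : g 0 0 * g 1 1 - g 0 1 * g 1 0 = 1 := by
  rw [← det_fin_two, g.det_coe]

theorem mul_entry (g h : SL(2, R)) (i j : Fin 2) : (g * h) i j = g i 0 * h 0 j + g i 1 * h 1 j := by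
  rw [Matrix.SpecialLinearGroup.coe_mul, mul_apply, Fin.sum_univ_two]

theorem ext_entries {g h : SL(2, R)} (h00 : g 0 0 = h 0 0) (h01 : g 0 1 = h 0 1)
    (h10 : g 1 0 = h 1 0) (h11 : g 1 1 = h 1 1) : g = h := by
  ext i j
  fin_cases i <;> fin_cases j <;> assumption

end Entries

section Conjugacy

variable {F : Type*} [Field F]

/-- The binary quadratic form `v ↦ det (v, g v)`, for `v = (x, y)`. It is `μ` at `v` exactly when
`v` and `μ⁻¹ g v` form a basis of determinant `1`. -/
def cyclicForm (g : SL(2, F)) (x y : F) : F :=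
  g 1 0 * x ^ 2 + (g 1 1 - g 0 0) * x * y + -g 0 1 * y ^ 2

/-- The matrix of trace `t` and determinant `1` which sends `e₁` to `μ e₂`: the companion matrix
of `X ^ 2 - t X + 1`, conjugated by a diagonal matrix of determinant `μ`. -/
def twistedCompanion (μ : Fˣ) (t : F) : SL(2, F) :=
  ⟨!![0, -(μ : F)⁻¹; μ, t], by simp [det_fin_two]⟩

@[simp]
theorem trace_twistedCompanion (μ : Fˣ) (t : F) : (twistedCompanion μ t).1.trace = t := by
  simp [twistedCompanion, trace_fin_two]

theorem isConj_twistedCompanion_of_cyclicForm_eq {g : SL(2, F)} {x y : F} {μ : Fˣ}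
    (h : cyclicForm g x y = μ) : IsConj g (twistedCompanion μ g.1.trace) := by
  have hd := det_entries g
  have hμ := μ.ne_zero
  let P : SL(2, F) :=
    ⟨!![x, (g 0 0 * x + g 0 1 * y) / μ; y, (g 1 0 * x + g 1 1 * y) / μ], by
      rw [det_fin_two_of]
      field_simp
      rw [← h, cyclicForm]
      ring⟩
  refine IsConj.symm (isConj_iff.2 ⟨P, ?_⟩)
  rw [mul_inv_eq_iff_eq_mul]
  apply ext_entries <;> rw [mul_entry, mul_entry] <;>
    simp only [P, twistedCompanion, trace_fin_two, of_apply, cons_val', cons_val_zero, cons_val_one,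
      cons_val_fin_one] <;> field_simp
  · ring
  · linear_combination x * hd
  · ring
  · linear_combination y * hd

theorem exists_sq_mul_of_isConj_twistedCompanion {ε : F} (hε : ε ^ 2 = 1) {μ ν : Fˣ}
    (h : IsConj (twistedCompanion μ (2 * ε)) (twistedCompanion ν (2 * ε))) :
    ∃ s : F, (μ : F) = ν * s ^ 2 := by
  obtain ⟨P, hP⟩ := isConj_iff.1 h
  rw [mul_inv_eq_iff_eq_mul] at hP
  have hd := det_entries P
  have hν := ν.ne_zero
  have e00 := congrArg (fun g => g 0 0) hP
  have e10 := congrArg (fun g => g 1 0) hP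
  simp only [mul_entry] at e00 e10
  simp only [twistedCompanion, of_apply, cons_val', cons_val_zero, cons_val_fin_one,
    cons_val_one, mul_zero, zero_mul, zero_add, neg_mul] at e00 e10
  refine ⟨P 0 0 + ε * P 1 0 * (ν : F)⁻¹, ?_⟩
  field_simp at e00 ⊢
  linear_combination -(μ * ν : F) * hd + P 0 0 * ν * e10 - P 1 0 * e00 - P 1 0 ^ 2 * hε

theorem isConj_twistedCompanion_mul_sq (μ s : Fˣ) (t : F) :
    IsConj (twistedCompanion μ t) (twistedCompanion (μ * s ^ 2) t) := by
  have h : cyclicForm (twistedCompanion μ t) s 0 = ↑(μ * s ^ 2) := by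
    simp [cyclicForm, twistedCompanion]
  simpa only [trace_twistedCompanion] using isConj_twistedCompanion_of_cyclicForm_eq h

theorem eq_one_or_neg_one_of_cyclicForm_eq_zero {g : SL(2, F)} (h : ∀ x y, cyclicForm g x y = 0) :
    g = 1 ∨ g = -1 := by
  have h10 : g 1 0 = 0 := by simpa [cyclicForm] using h 1 0
  have h01 : g 0 1 = 0 := by simpa [cyclicForm] using h 0 1
  have hdiag : g 1 1 = g 0 0 := by
    simpa [cyclicForm, h10, h01, sub_eq_zero] using h 1 1
  have hd := det_entries g
  rw [h10, hdiag, mul_zero, sub_zero, mul_self_eq_one_iff] at hd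
  rcases hd with h00 | h00 <;> rw [h00] at hdiag
  · exact .inl (ext_entries h00 h01 h10 hdiag)
  · exact .inr (ext_entries h00 (h01.trans neg_zero.symm) (h10.trans neg_zero.symm) hdiag)

theorem eq_one_or_neg_one_or_isConj_twistedCompanion (g : SL(2, F)) :
    g = 1 ∨ g = -1 ∨ ∃ μ, IsConj g (twistedCompanion μ g.1.trace) := by
  by_cases h : ∀ x y, cyclicForm g x y = 0
  · exact or_assoc.1 (.inl (eq_one_or_neg_one_of_cyclicForm_eq_zero h))
  · push Not at h
    obtain ⟨x, y, hxy⟩ := h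
    exact .inr (.inr ⟨Units.mk0 _ hxy, isConj_twistedCompanion_of_cyclicForm_eq rfl⟩)

theorem isConj_twistedCompanion_one [Finite F] {g : SL(2, F)} (ht : g.1.trace ^ 2 ≠ 4) :
    IsConj g (twistedCompanion 1 g.1.trace) := by
  have hdiscrim : discrim (g 1 0) (g 1 1 - g 0 0) (-g 0 1) ≠ 0 := by
    intro h
    rw [discrim] at h
    rw [trace_fin_two] at ht
    exact ht (by linear_combination h + 4 * det_entries g)
  obtain ⟨x, y, h⟩ := exists_quadraticForm_eq hdiscrim 1
  exact isConj_twistedCompanion_of_cyclicForm_eq h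

theorem isConj_iff_trace_eq [Finite F] {g h : SL(2, F)} (ht : g.1.trace ^ 2 ≠ 4) :
    IsConj g h ↔ g.1.trace = h.1.trace := by
  refine ⟨trace_eq_of_isConj, fun e => ?_⟩
  have hg := isConj_twistedCompanion_one ht
  rw [e] at ht hg
  exact hg.trans (isConj_twistedCompanion_one ht).symm

theorem isConj_twistedCompanion_one_or [Finite F] {δ : Fˣ} (hδ : ¬IsSquare δ) (μ : Fˣ) (t : F) :
    IsConj (twistedCompanion μ t) (twistedCompanion 1 t) ∨
      IsConj (twistedCompanion μ t) (twistedCompanion δ t) := by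
  by_cases hμ : IsSquare μ
  · obtain ⟨s, rfl⟩ := hμ
    left
    simpa only [one_mul, sq] using (isConj_twistedCompanion_mul_sq 1 s t).symm
  · obtain ⟨s, hs⟩ := isSquare_mul_of_not_isSquare hμ (hδ ∘ isSquare_inv.1)
    right
    rw [mul_inv_eq_iff_eq_mul, ← sq, mul_comm] at hs
    exact hs ▸ (isConj_twistedCompanion_mul_sq δ s t).symm

end Conjugacy

section TraceFibres

variable {F : Type*} [Field F] (t : F)

theorem ncard_setOf_trace_eq_and_lower_ne_zero :
    {g : SL(2, F) | g.1.trace = t ∧ g 1 0 ≠ 0}.ncard = Nat.card F * Nat.card Fˣ := by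
  rw [← Nat.card_prod, ← Nat.card_coe_set_eq]
  refine Nat.card_congr
    { toFun := fun g => (g.1 0 0, Units.mk0 (g.1 1 0) g.2.2)
      invFun := fun p =>
        ⟨⟨!![p.1, (p.1 * (t - p.1) - 1) * (p.2 : F)⁻¹; p.2, t - p.1], by simp [det_fin_two]⟩,
          by simp [trace_fin_two], p.2.ne_zero⟩
      left_inv := ?_
      right_inv := fun p => by simp }
  rintro ⟨g, rfl, hg⟩
  refine Subtype.ext (ext_entries rfl ?_ rfl ?_) <;>
    simp only [trace_fin_two, of_apply, cons_val', cons_val_zero, cons_val_one, cons_val_fin_one,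
      Units.val_mk0]
  · field_simp
    linear_combination det_entries g
  · ring

theorem ncard_setOf_trace_eq_and_lower_eq_zero :
    {g : SL(2, F) | g.1.trace = t ∧ g 1 0 = 0}.ncard =
      {x | x * (t - x) = 1}.ncard * Nat.card F := by
  rw [← Nat.card_coe_set_eq, ← Nat.card_coe_set_eq, ← Nat.card_prod]
  refine Nat.card_congr
    { toFun := fun g => (⟨g.1 0 0, ?_⟩, g.1 0 1)
      invFun := fun p =>
        ⟨⟨!![p.1.1, p.2; 0, t - p.1.1], by rw [det_fin_two_of, mul_zero, sub_zero]; exact p.1.2⟩,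
          by simp [trace_fin_two], rfl⟩
      left_inv := ?_
      right_inv := fun p => by simp }
  · obtain ⟨g, ht, hg⟩ := g
    change g 0 0 * (t - g 0 0) = 1
    rw [← ht, trace_fin_two]
    linear_combination det_entries g + g 0 1 * hg
  · rintro ⟨g, rfl, hg⟩
    refine Subtype.ext (ext_entries rfl rfl hg.symm ?_)
    simp [trace_fin_two]

variable [Finite F]

theorem ncard_setOf_trace_eq :
    {g : SL(2, F) | g.1.trace = t}.ncard =
      Nat.card F * (Nat.card F - 1) + {x | x * (t - x) = 1}.ncard * Nat.card F := by
  rw [← Nat.card_units, ← ncard_setOf_trace_eq_and_lower_ne_zero t,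
    ← ncard_setOf_trace_eq_and_lower_eq_zero, ← Set.ncard_union_eq]
  · congr 1
    ext g
    simp only [Set.mem_ofPred_eq, Set.mem_union, ← and_or_left, or_comm (a := _ ≠ _), em, and_true]
  · exact Set.disjoint_left.2 fun g h h' => h.2 h'.2

theorem ncard_setOf_trace_mem {T : Set F} {k : ℕ} (h : ∀ t ∈ T, {x | x * (t - x) = 1}.ncard = k) :
    {g : SL(2, F) | g.1.trace ∈ T}.ncard =
      T.ncard * (Nat.card F * (Nat.card F - 1) + k * Nat.card F) :=
  ncard_preimage_eq_mul T.toFinite fun t ht => by rw [ncard_setOf_trace_eq, h t ht]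

end TraceFibres

section Powers

theorem trace_pow {R : Type*} [CommRing R] (g : SL(2, R)) (n : ℕ) :
    (g ^ n).1.trace = (dickson 1 1 n).eval g.1.trace := by
  induction n using Nat.twoStepInduction with
  | zero =>
    simp only [pow_zero, Matrix.SpecialLinearGroup.coe_one, trace_one, dickson_zero,
      Fintype.card_fin]
    norm_num
  | one => simp only [pow_one, dickson_one, eval_X]
  | more n ih₀ ih₁ =>
    have hrec : (g ^ (n + 2)).1.trace = g.1.trace * (g ^ (n + 1)).1.trace - (g ^ n).1.trace := by
      rw [pow_succ, pow_succ]
      simp only [trace_fin_two, mul_entry]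
      linear_combination -((g ^ n) 0 0 + (g ^ n) 1 1) * det_entries g
    rw [hrec, ih₀, ih₁, dickson_add_two, eval_sub, eval_mul, eval_mul, eval_X, eval_C, one_mul]

theorem sub_scalar_sq_eq_zero {R : Type*} [CommRing R] {g : SL(2, R)} {ε : R} (hε : ε ^ 2 = 1)
    (ht : g.1.trace = 2 * ε) : (g.1 - scalar (Fin 2) ε) ^ 2 = 0 := by
  have hd := det_entries g
  rw [trace_fin_two] at ht
  ext i j
  fin_cases i <;> fin_cases j <;>
    simp only [scalar_apply, Fin.zero_eta, Fin.mk_one, sq, mul_apply, Matrix.sub_apply,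
      Fin.sum_univ_two, diagonal_apply_eq, diagonal_apply_ne, ne_eq, zero_ne_one, one_ne_zero,
      not_false_eq_true, sub_zero, Matrix.zero_apply]
  · linear_combination g 0 0 * ht - hd + hε
  · linear_combination g 0 1 * ht
  · linear_combination g 1 0 * ht
  · linear_combination g 1 1 * ht - hd + hε

variable {F : Type*} [Field F]

theorem pow_char_eq_one_or_neg_one (p : ℕ) [Fact p.Prime] [CharP F p] {g : SL(2, F)}
    (ht : g.1.trace ^ 2 = 4) : g ^ p = 1 ∨ g ^ p = -1 := by
  obtain ⟨ε, hε, htε⟩ := exists_sq_eq_one_of_sq_eq_four ht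
  have hpow : g.1 ^ p = scalar (Fin 2) ε ^ p := by
    rw [← sub_eq_zero, ← sub_pow_expChar_of_commute p (scalar_commute ε (Commute.all ε) g.1).symm]
    exact pow_eq_zero_of_le (Fact.out (p := p.Prime)).two_le (sub_scalar_sq_eq_zero hε htε)
  have hεp : ε ^ p = 1 ∨ ε ^ p = -1 := by
    rw [← sq_eq_one_iff, pow_right_comm, hε, one_pow]
  refine hεp.imp (fun h => Subtype.ext ?_) fun h => Subtype.ext ?_ <;>
    rw [Matrix.SpecialLinearGroup.coe_pow, hpow, ← map_pow, h]
  · rw [map_one, Matrix.SpecialLinearGroup.coe_one]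
  · rw [map_neg, map_one, Matrix.SpecialLinearGroup.coe_neg, Matrix.SpecialLinearGroup.coe_one]

theorem trace_sq_eq_four_of_trace_pow_char_sq_eq_four (p : ℕ) [Fact p.Prime] [CharP F p]
    {g : SL(2, F)} (ht : (g ^ p).1.trace ^ 2 = 4) : g.1.trace ^ 2 = 4 := by
  rw [trace_pow, dickson_one_one_charP, eval_pow, eval_X, pow_right_comm] at ht
  exact frobenius_inj F p (by rw [frobenius_def, ht, map_ofNat])

variable [Finite F]

theorem coprime_natCard_iff (p : ℕ) [hp : Fact p.Prime] [CharP F p] {n : ℕ} :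
    n.Coprime (Nat.card F) ↔ ¬p ∣ n := by
  have := Fintype.ofFinite F
  obtain ⟨k, -, hk⟩ := FiniteField.card F p
  rw [Nat.card_eq_fintype_card, hk, Nat.coprime_pow_right_iff k.pos, Nat.coprime_comm,
    hp.out.coprime_iff_not_dvd]

theorem exists_pow_eq_of_trace_sq_eq_four {n : ℕ} (hn : Odd n) (hnF : n.Coprime (Nat.card F))
    {g : SL(2, F)} (ht : g.1.trace ^ 2 = 4) : ∃ x, x ^ n = g := by
  obtain ⟨p, hp⟩ := CharP.exists F
  have : Fact p.Prime := ⟨CharP.char_is_prime F p⟩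
  have horder : orderOf g ∣ p * 2 := orderOf_dvd_of_pow_eq_one <| by
    rw [pow_mul]
    rcases pow_char_eq_one_or_neg_one p ht with h | h <;> simp [h]
  have hcop : n.Coprime (p * 2) :=
    (Nat.coprime_comm.1 <| (Nat.Prime.coprime_iff_not_dvd Fact.out).2 <|
      (coprime_natCard_iff p).1 hnF).mul_right hn.coprime_two_right
  obtain ⟨m, hm⟩ := exists_pow_eq_self_of_coprime (hcop.coprime_dvd_right horder)
  exact ⟨g ^ m, by rw [pow_right_comm, hm]⟩

theorem pow_eq_one_or_neg_one_of_trace_sq_eq_four {n : ℕ} (hnF : ¬n.Coprime (Nat.card F))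
    {x : SL(2, F)} (ht : (x ^ n).1.trace ^ 2 = 4) : x ^ n = 1 ∨ x ^ n = -1 := by
  obtain ⟨p, hp⟩ := CharP.exists F
  have : Fact p.Prime := ⟨CharP.char_is_prime F p⟩
  rw [coprime_natCard_iff p, not_not] at hnF
  obtain ⟨m, rfl⟩ := hnF
  rw [mul_comm, pow_mul] at ht ⊢
  exact pow_char_eq_one_or_neg_one p (trace_sq_eq_four_of_trace_pow_char_sq_eq_four p ht)

end Powers

section PowerSet

variable (F : Type u) [Field F] (n : ℕ)

/-- The `n`-th powers of `SL₂(F)` which are unipotent or the negative of a unipotent, that is,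
those of trace `±2`. -/
def quasiUnipotentPowers : Set SL(2, F) :=
  {g | (∃ x, x ^ n = g) ∧ g.1.trace ^ 2 = 4}

variable {F n}

theorem sq_trace_of_eq_one_or_neg_one {g : SL(2, F)} (hg : g = 1 ∨ g = -1) :
    g.1.trace ^ 2 = 4 := by
  rw [trace_fin_two]
  rcases hg with rfl | rfl <;> norm_num

theorem sq_ne_four_of_mem_torusTraces_union {m m' : ℕ} {t : F}
    (ht : t ∈ torusTraces F m ∪ torusTraces F m') : t ^ 2 ≠ 4 :=
  ht.elim sq_ne_four_of_mem_torusTraces sq_ne_four_of_mem_torusTraces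

variable [Finite F]

theorem quasiUnipotentPowers_of_coprime (hn : Odd n) (hnF : n.Coprime (Nat.card F)) :
    quasiUnipotentPowers F n = {g | g.1.trace ∈ {t : F | t ^ 2 = 4}} :=
  Set.ext fun _ => and_iff_right_of_imp (exists_pow_eq_of_trace_sq_eq_four hn hnF)

theorem quasiUnipotentPowers_of_not_coprime (hn : Odd n) (hnF : ¬n.Coprime (Nat.card F)) :
    quasiUnipotentPowers F n = {1, -1} := by
  ext g
  refine ⟨?_, fun hg => ⟨⟨g, ?_⟩, sq_trace_of_eq_one_or_neg_one hg⟩⟩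
  · rintro ⟨⟨x, rfl⟩, ht⟩
    exact pow_eq_one_or_neg_one_of_trace_sq_eq_four hnF ht
  · rcases hg with rfl | rfl
    · exact one_pow n
    · exact hn.neg_one_pow

theorem exists_pow_eq_iff_of_trace_sq_ne_four {g : SL(2, F)} (ht : g.1.trace ^ 2 ≠ 4) :
    (∃ x, x ^ n = g) ↔ ∃ s, (dickson 1 1 n).eval s = g.1.trace := by
  constructor
  · rintro ⟨x, rfl⟩
    exact ⟨x.1.trace, (trace_pow x n).symm⟩
  · rintro ⟨s, hs⟩
    have htr : g.1.trace = (twistedCompanion 1 s ^ n).1.trace := by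
      rw [trace_pow, trace_twistedCompanion, hs]
    obtain ⟨c, hc⟩ := isConj_iff.1 ((isConj_iff_trace_eq ht).2 htr).symm
    exact ⟨c * twistedCompanion 1 s * c⁻¹, by rw [conj_pow, hc]⟩

variable (F n) in
theorem setOf_exists_pow_eq :
    {g : SL(2, F) | ∃ x, x ^ n = g} =
      {g | g.1.trace ∈ torusTraces F ((Nat.card F - 1) / (Nat.card F - 1).gcd n) ∪
        torusTraces F ((Nat.card F + 1) / (Nat.card F + 1).gcd n)} ∪
      quasiUnipotentPowers F n := by
  rw [← setOf_dickson_eval_of_sq_ne_four]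
  ext g
  by_cases ht : g.1.trace ^ 2 = 4
  · simp [quasiUnipotentPowers, ht]
  · simp [quasiUnipotentPowers, ht, exists_pow_eq_iff_of_trace_sq_ne_four ht]

end PowerSet

section PowerCount

variable (F : Type u) [Field F] [Finite F] (n : ℕ)

theorem disjoint_torusTraces_div_gcd :
    Disjoint (torusTraces F ((Nat.card F - 1) / (Nat.card F - 1).gcd n))
      (torusTraces F ((Nat.card F + 1) / (Nat.card F + 1).gcd n)) :=
  disjoint_torusTraces.mono
    (torusTraces_subset_of_dvd (Nat.div_dvd_of_dvd (Nat.gcd_dvd_left _ _)))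
    (torusTraces_subset_of_dvd (Nat.div_dvd_of_dvd (Nat.gcd_dvd_left _ _)))

theorem numPowers_eq :
    numPowers n F =
      (torusTraces F ((Nat.card F - 1) / (Nat.card F - 1).gcd n)).ncard *
          (Nat.card F * (Nat.card F + 1)) +
        (torusTraces F ((Nat.card F + 1) / (Nat.card F + 1).gcd n)).ncard *
          (Nat.card F * (Nat.card F - 1)) +
        (quasiUnipotentPowers F n).ncard := by
  have hsplit {m m' : ℕ} : {g : SL(2, F) | g.1.trace ∈ torusTraces F m ∪ torusTraces F m'} =
      {g | g.1.trace ∈ torusTraces F m} ∪ {g | g.1.trace ∈ torusTraces F m'} := rfl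
  have hcard : Nat.card F - 1 + 2 = Nat.card F + 1 := by
    have := Nat.card_pos (α := F)
    omega
  rw [numPowers, setOf_exists_pow_eq, Set.ncard_union_eq, hsplit, Set.ncard_union_eq,
    ncard_setOf_trace_mem (k := 2), ncard_setOf_trace_mem (k := 0), zero_mul, add_zero,
    mul_comm 2, ← mul_add, hcard]
  · exact fun t ht => ncard_roots_of_mem_torusTraces_add_one
      (torusTraces_subset_of_dvd (Nat.div_dvd_of_dvd (Nat.gcd_dvd_left _ _)) ht)
  · exact fun t ht => ncard_roots_of_mem_torusTraces_sub_one
      (torusTraces_subset_of_dvd (Nat.div_dvd_of_dvd (Nat.gcd_dvd_left _ _)) ht)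
  · exact (disjoint_torusTraces_div_gcd F n).preimage _
  · exact Set.disjoint_left.2 fun g hg hg' => sq_ne_four_of_mem_torusTraces_union hg hg'.2

variable {F} in
theorem ncard_image_mk_setOf_trace_mem {T : Set F} (hT : ∀ t ∈ T, t ^ 2 ≠ 4) :
    (ConjClasses.mk '' {g : SL(2, F) | g.1.trace ∈ T}).ncard = T.ncard := by
  have himage : ConjClasses.mk '' {g : SL(2, F) | g.1.trace ∈ T} =
      (fun t => ConjClasses.mk (twistedCompanion 1 t)) '' T := by
    ext C
    constructor
    · rintro ⟨g, hg, rfl⟩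
      exact ⟨g.1.trace, hg,
        (ConjClasses.mk_eq_mk_iff_isConj.2 (isConj_twistedCompanion_one (hT _ hg))).symm⟩
    · rintro ⟨t, ht, rfl⟩
      exact ⟨_, by simpa only [Set.mem_ofPred_eq, trace_twistedCompanion] using ht, rfl⟩
  rw [himage, Set.ncard_image_of_injective]
  intro s t h
  simpa only [trace_twistedCompanion] using
    trace_eq_of_isConj (ConjClasses.mk_eq_mk_iff_isConj.1 h)

theorem numPowerClasses_eq :
    numPowerClasses n F =
      (torusTraces F ((Nat.card F - 1) / (Nat.card F - 1).gcd n)).ncard +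
        (torusTraces F ((Nat.card F + 1) / (Nat.card F + 1).gcd n)).ncard +
        (ConjClasses.mk '' quasiUnipotentPowers F n).ncard := by
  have hclasses : {C : ConjClasses SL(2, F) | IsPowerClass n C} =
      ConjClasses.mk '' {g | ∃ x, x ^ n = g} := by
    ext C
    exact ⟨fun ⟨x, hx⟩ => ⟨_, ⟨x, rfl⟩, hx⟩, fun ⟨_, ⟨x, hx⟩, hC⟩ => ⟨x, hx ▸ hC⟩⟩
  have : Finite (ConjClasses SL(2, F)) := .of_surjective _ ConjClasses.mk_surjective
  rw [numPowerClasses, hclasses, setOf_exists_pow_eq, Set.image_union, Set.ncard_union_eq,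
    ncard_image_mk_setOf_trace_mem fun t => sq_ne_four_of_mem_torusTraces_union,
    Set.ncard_union_eq (disjoint_torusTraces_div_gcd F n)]
  refine Set.disjoint_left.2 ?_
  rintro _ ⟨g, hg, rfl⟩ ⟨h, hh, hgh⟩
  apply sq_ne_four_of_mem_torusTraces_union hg
  rw [← trace_eq_of_isConj (ConjClasses.mk_eq_mk_iff_isConj.1 hgh), hh.2]

end PowerCount

section QuasiUnipotent

variable {F : Type*} [Field F]

theorem not_isConj_twistedCompanion_of_eq_one_or_neg_one {z : SL(2, F)} (hz : z = 1 ∨ z = -1)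
    (μ : Fˣ) (t : F) : ¬IsConj z (twistedCompanion μ t) := by
  intro h
  have hconj : z = twistedCompanion μ t := by
    obtain ⟨c, hc⟩ := isConj_iff.1 h
    rcases hz with rfl | rfl <;> simpa using hc
  have hlower : z 1 0 = μ := congrArg (fun g : SL(2, F) => g 1 0) hconj
  rcases hz with rfl | rfl <;> exact μ.ne_zero (by simpa using hlower.symm)

theorem injOn_mk_twistedCompanion {δ : Fˣ} (hδ : ¬IsSquare δ) :
    Set.InjOn (fun p : Fˣ × F => ConjClasses.mk (twistedCompanion p.1 p.2))
      ({1, δ} ×ˢ {t | t ^ 2 = 4}) := by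
  rintro ⟨μ, t⟩ ⟨hμ, ht⟩ ⟨ν, s⟩ ⟨hν, -⟩ h
  replace h := ConjClasses.mk_eq_mk_iff_isConj.1 h
  obtain rfl : t = s := by simpa only [trace_twistedCompanion] using trace_eq_of_isConj h
  obtain ⟨ε, hε, rfl⟩ := exists_sq_eq_one_of_sq_eq_four ht
  have hsq {μ ν : Fˣ} (h : IsConj (twistedCompanion μ (2 * ε)) (twistedCompanion ν (2 * ε))) :
      IsSquare (ν⁻¹ * μ) := by
    obtain ⟨x, hx⟩ := exists_sq_mul_of_isConj_twistedCompanion hε h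
    have hx0 : x ≠ 0 := by
      rintro rfl
      simp at hx
    refine ⟨Units.mk0 x hx0, ?_⟩
    rw [inv_mul_eq_iff_eq_mul, ← sq]
    exact Units.ext hx
  rcases hμ with rfl | rfl <;> rcases hν with rfl | rfl
  · rfl
  · exact (hδ (by simpa using hsq h.symm)).elim
  · exact (hδ (by simpa using hsq h)).elim
  · rfl

theorem image_mk_setOf_trace_sq_eq_four [Finite F] {δ : Fˣ} (hδ : ¬IsSquare δ) :
    ConjClasses.mk '' {g : SL(2, F) | g.1.trace ∈ {t : F | t ^ 2 = 4}} =
      {ConjClasses.mk 1, ConjClasses.mk (-1)} ∪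
        (fun p : Fˣ × F => ConjClasses.mk (twistedCompanion p.1 p.2)) ''
          ({1, δ} ×ˢ {t | t ^ 2 = 4}) := by
  ext C
  constructor
  · rintro ⟨g, ht, rfl⟩
    rcases eq_one_or_neg_one_or_isConj_twistedCompanion g with rfl | rfl | ⟨μ, hμ⟩
    · exact .inl (.inl rfl)
    · exact .inl (.inr rfl)
    · right
      rcases isConj_twistedCompanion_one_or hδ μ g.1.trace with h | h
      · exact ⟨(1, _), ⟨.inl rfl, ht⟩, ConjClasses.mk_eq_mk_iff_isConj.2 (hμ.trans h).symm⟩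
      · exact ⟨(δ, _), ⟨.inr rfl, ht⟩, ConjClasses.mk_eq_mk_iff_isConj.2 (hμ.trans h).symm⟩
  · rintro ((rfl | rfl) | ⟨⟨μ, t⟩, ⟨-, ht⟩, rfl⟩)
    · exact ⟨1, sq_trace_of_eq_one_or_neg_one (.inl rfl), rfl⟩
    · exact ⟨-1, sq_trace_of_eq_one_or_neg_one (.inr rfl), rfl⟩
    · exact ⟨_, by simpa only [Set.mem_ofPred_eq, trace_twistedCompanion] using ht, rfl⟩

variable [NeZero (2 : F)]

variable (F) in
theorem two_ne_neg_two : (2 : F) ≠ -2 := by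
  intro h
  have : (2 : F) * 2 = 0 := by linear_combination h
  exact two_ne_zero (mul_self_eq_zero.1 this)

theorem ncard_setOf_sq_eq_four : {t : F | t ^ 2 = 4}.ncard = 2 := by
  simp only [sq_eq_four_iff]
  exact Set.ncard_pair (two_ne_neg_two F)

theorem mk_one_ne_mk_neg_one : ConjClasses.mk (1 : SL(2, F)) ≠ ConjClasses.mk (-1) := by
  intro h
  have ht := trace_eq_of_isConj (ConjClasses.mk_eq_mk_iff_isConj.1 h)
  simp only [trace_fin_two] at ht
  exact two_ne_neg_two F (by norm_num at ht ⊢; exact ht)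

variable [Finite F]

variable (F) in
theorem ncard_setOf_trace_sq_eq_four :
    {g : SL(2, F) | g.1.trace ∈ {t : F | t ^ 2 = 4}}.ncard = 2 * Nat.card F ^ 2 := by
  have hroots : ∀ t ∈ {t : F | t ^ 2 = 4}, {x | x * (t - x) = 1}.ncard = 1 :=
    fun t ht => ncard_roots_of_sq_eq_four ht
  rw [ncard_setOf_trace_mem hroots, ncard_setOf_sq_eq_four, one_mul, ← Nat.mul_succ,
    Nat.succ_eq_add_one, Nat.sub_add_cancel Nat.card_pos, sq]

variable (F) in
theorem ncard_image_mk_setOf_trace_sq_eq_four :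
    (ConjClasses.mk '' {g : SL(2, F) | g.1.trace ∈ {t : F | t ^ 2 = 4}}).ncard = 6 := by
  obtain ⟨δ, hδ⟩ := exists_unit_not_isSquare F
  have hδ1 : 1 ≠ δ := by
    rintro rfl
    exact hδ IsSquare.one
  have : Finite (ConjClasses SL(2, F)) := .of_surjective _ ConjClasses.mk_surjective
  rw [image_mk_setOf_trace_sq_eq_four hδ, Set.ncard_union_eq, Set.ncard_pair mk_one_ne_mk_neg_one,
    (injOn_mk_twistedCompanion hδ).ncard_image, Set.ncard_prod, Set.ncard_pair hδ1,
    ncard_setOf_sq_eq_four]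
  refine Set.disjoint_left.2 ?_
  rintro _ (hz | hz) ⟨p, -, rfl⟩ <;>
    refine not_isConj_twistedCompanion_of_eq_one_or_neg_one ?_ p.1 p.2
      (ConjClasses.mk_eq_mk_iff_isConj.1 (Eq.symm hz))
  · exact .inl rfl
  · exact .inr rfl

end QuasiUnipotent

section Formulas

variable {F : Type u} [Field F] [Finite F] (hq : Odd (Nat.card F)) {n : ℕ} (hn : Odd n)

include hq in
theorem ncard_image_mk_one_neg_one :
    (ConjClasses.mk '' {(1 : SL(2, F)), -1}).ncard = 2 := by
  have := neZero_two_of_odd_natCard hq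
  rw [Set.image_pair, Set.ncard_pair mk_one_ne_mk_neg_one]

include hq in
theorem ncard_one_neg_one : ({1, -1} : Set SL(2, F)).ncard = 2 := by
  have := neZero_two_of_odd_natCard hq
  exact Set.ncard_pair fun h => mk_one_ne_mk_neg_one (congrArg ConjClasses.mk h)

include hq hn

theorem ncard_torusTraces_div_gcd {N : ℕ} (hN : N = Nat.card F - 1 ∨ N = Nat.card F + 1) :
    ((torusTraces F (N / N.gcd n)).ncard : ℝ) = N / (2 * N.gcd n) - 1 := by
  have := neZero_two_of_odd_natCard hq
  have hdvd : N.gcd n ∣ N := Nat.gcd_dvd_left N n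
  have hgcd : (N.gcd n : ℝ) ≠ 0 := by
    exact_mod_cast (Nat.gcd_pos_of_pos_right N hn.pos).ne'
  have hN_even : Even N := by
    rcases hN with rfl | rfl
    · exact hq.tsub_odd odd_one
    · exact hq.add_odd odd_one
  have heven : Even (N / N.gcd n) := by
    rw [← Nat.mul_div_cancel' hdvd, Nat.even_mul] at hN_even
    exact hN_even.resolve_left (Nat.not_even_iff_odd.2 (hn.of_dvd_nat (Nat.gcd_dvd_right N n)))
  have hcard := ncard_torusTraces (F := F)
    (hN.imp (fun h => h ▸ Nat.div_dvd_of_dvd hdvd) fun h => h ▸ Nat.div_dvd_of_dvd hdvd) heven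
  replace hcard := congrArg (Nat.cast (R := ℝ)) hcard
  rw [Nat.cast_div hdvd hgcd] at hcard
  push_cast at hcard
  rw [mul_comm, ← div_div, ← hcard]
  ring

theorem cast_numPowerClasses_eq :
    (numPowerClasses n F : ℝ) =
      (Nat.card F - 1) / (2 * (Nat.card F - 1).gcd n) +
        (Nat.card F + 1) / (2 * (Nat.card F + 1).gcd n) +
        ((ConjClasses.mk '' quasiUnipotentPowers F n).ncard - 2) := by
  rw [numPowerClasses_eq, Nat.cast_add, Nat.cast_add, ncard_torusTraces_div_gcd hq hn (.inl rfl),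
    ncard_torusTraces_div_gcd hq hn (.inr rfl), Nat.cast_pred Nat.card_pos, Nat.cast_succ]
  ring

theorem cast_numPowers_eq :
    (numPowers n F : ℝ) =
      (Nat.card F ^ 3 - Nat.card F) *
          (1 / (2 * (Nat.card F - 1).gcd n) + 1 / (2 * (Nat.card F + 1).gcd n)) +
        ((quasiUnipotentPowers F n).ncard - 2 * Nat.card F ^ 2) := by
  rw [numPowers_eq, Nat.cast_add, Nat.cast_add, Nat.cast_mul,
    ncard_torusTraces_div_gcd hq hn (.inl rfl), Nat.cast_mul (Set.ncard _),
    ncard_torusTraces_div_gcd hq hn (.inr rfl)]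
  push_cast [Nat.cast_pred (R := ℝ) (Nat.card_pos (α := F))]
  ring

theorem numPowerClasses_eq_of_coprime (hnF : n.Coprime (Nat.card F)) :
    (numPowerClasses n F : ℝ) =
      (Nat.card F - 1) / (2 * (Nat.card F - 1).gcd n) +
        (Nat.card F + 1) / (2 * (Nat.card F + 1).gcd n) + 4 := by
  have := neZero_two_of_odd_natCard hq
  rw [cast_numPowerClasses_eq hq hn, quasiUnipotentPowers_of_coprime hn hnF,
    ncard_image_mk_setOf_trace_sq_eq_four]
  norm_num

theorem numPowers_eq_of_coprime (hnF : n.Coprime (Nat.card F)) :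
    (numPowers n F : ℝ) =
      (Nat.card F ^ 3 - Nat.card F) *
        (1 / (2 * (Nat.card F - 1).gcd n) + 1 / (2 * (Nat.card F + 1).gcd n)) := by
  have := neZero_two_of_odd_natCard hq
  rw [cast_numPowers_eq hq hn, quasiUnipotentPowers_of_coprime hn hnF, ncard_setOf_trace_sq_eq_four]
  push_cast
  ring

theorem numPowerClasses_eq_of_not_coprime (hnF : ¬n.Coprime (Nat.card F)) :
    (numPowerClasses n F : ℝ) =
      (Nat.card F - 1) / (2 * (Nat.card F - 1).gcd n) +
        (Nat.card F + 1) / (2 * (Nat.card F + 1).gcd n) := by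
  rw [cast_numPowerClasses_eq hq hn, quasiUnipotentPowers_of_not_coprime hn hnF,
    ncard_image_mk_one_neg_one hq, Nat.cast_ofNat, sub_self, add_zero]

theorem numPowers_eq_of_not_coprime (hnF : ¬n.Coprime (Nat.card F)) :
    (numPowers n F : ℝ) =
      (Nat.card F ^ 3 - Nat.card F) *
          (1 / (2 * (Nat.card F - 1).gcd n) + 1 / (2 * (Nat.card F + 1).gcd n)) +
        (2 - 2 * Nat.card F ^ 2) := by
  rw [cast_numPowers_eq hq hn, quasiUnipotentPowers_of_not_coprime hn hnF, ncard_one_neg_one hq,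
    Nat.cast_ofNat]

omit hn

theorem natCard_specialLinearGroup_two :
    (Nat.card SL(2, F) : ℝ) = (Nat.card F - 1) * Nat.card F * (Nat.card F + 1) := by
  have h1 : numPowers 1 F = Nat.card SL(2, F) := by
    simp only [numPowers, pow_one, exists_eq, Set.ofPred_true, Set.ncard_univ]
  rw [← h1, numPowers_eq_of_coprime hq odd_one (Nat.coprime_one_left _), Nat.gcd_one_right,
    Nat.gcd_one_right]
  push_cast
  ring

theorem natCard_specialLinearGroup_two_eq_mul :
    Nat.card SL(2, F) = (Nat.card F - 1) * Nat.card F * (Nat.card F + 1) := by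
  have h := natCard_specialLinearGroup_two hq
  rw [← Nat.cast_pred Nat.card_pos] at h
  exact_mod_cast h

theorem natCard_conjClasses_specialLinearGroup_two :
    (Nat.card (ConjClasses SL(2, F)) : ℝ) = Nat.card F + 4 := by
  have h1 : numPowerClasses 1 F = Nat.card (ConjClasses SL(2, F)) := by
    simp only [numPowerClasses, IsPowerClass, pow_one, ConjClasses.exists_rep, Set.ofPred_true,
      Set.ncard_univ]
  rw [← h1, numPowerClasses_eq_of_coprime hq odd_one (Nat.coprime_one_left _), Nat.gcd_one_right,
    Nat.gcd_one_right]
  push_cast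
  ring

end Formulas

section Cases

theorem coprime_add_of_dvd {a b n : ℕ} (h : n ∣ a) (hb : n.Coprime b) : n.Coprime (a + b) := by
  obtain ⟨k, rfl⟩ := h
  exact (Nat.coprime_mul_left_add_right ..).2 hb

theorem coprime_of_dvd_add {a b n : ℕ} (h : n ∣ a + b) (hb : n.Coprime b) : n.Coprime a :=
  Nat.dvd_one.1 <| hb ▸ Nat.dvd_gcd (Nat.gcd_dvd_left n a)
    ((Nat.dvd_add_right (Nat.gcd_dvd_right n a)).1 ((Nat.gcd_dvd_left n a).trans h))

theorem gcd_sub_one_eq_one_of_dvd {n q : ℕ} (hq : 0 < q) (h : n ∣ q) : (q - 1).gcd n = 1 := by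
  rw [← Nat.sub_add_cancel hq] at h
  exact (coprime_of_dvd_add h n.coprime_one_right).symm

theorem gcd_add_one_eq_one_of_dvd {n q : ℕ} (h : n ∣ q) : (q + 1).gcd n = 1 :=
  (coprime_add_of_dvd h n.coprime_one_right).symm

theorem coprime_of_dvd_sub_one_or_add_one {n q : ℕ} (hq : 0 < q) (h : n ∣ q - 1 ∨ n ∣ q + 1) :
    n.Coprime q := by
  rcases h with h | h
  · rw [← Nat.sub_add_cancel hq]
    exact coprime_add_of_dvd h n.coprime_one_right
  · exact coprime_of_dvd_add h n.coprime_one_right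

theorem gcd_add_one_eq_one_of_dvd_sub_one {n q : ℕ} (hq : 0 < q) (hn : Odd n) (h : n ∣ q - 1) :
    (q + 1).gcd n = 1 := by
  rw [← Nat.sub_add_cancel hq]
  exact (coprime_add_of_dvd h hn.coprime_two_right).symm

theorem gcd_sub_one_eq_one_of_dvd_add_one {n q : ℕ} (hq : 0 < q) (hn : Odd n) (h : n ∣ q + 1) :
    (q - 1).gcd n = 1 := by
  rw [← Nat.sub_add_cancel hq, add_assoc] at h
  exact (coprime_of_dvd_add h hn.coprime_two_right).symm

variable {F : Type u} [Field F] [Finite F] {n : ℕ} (hq : Odd (Nat.card F))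

include hq

theorem dvd_sub_one_or_add_one_of_dvd_natCard (hn : n.Prime) (h : n ∣ Nat.card SL(2, F))
    (hnF : ¬n ∣ Nat.card F) : n ∣ Nat.card F - 1 ∨ n ∣ Nat.card F + 1 := by
  rw [natCard_specialLinearGroup_two_eq_mul hq, hn.dvd_mul, hn.dvd_mul] at h
  exact h.imp_left fun h => h.resolve_right hnF

variable (hn : Odd n)

include hn

theorem numPowerClasses_of_coprime_natCard (h : n.Coprime (Nat.card SL(2, F))) :
    (numPowerClasses n F : ℝ) = Nat.card F + 4 := by
  rw [natCard_specialLinearGroup_two_eq_mul hq, Nat.coprime_mul_iff_right,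
    Nat.coprime_mul_iff_right] at h
  rw [numPowerClasses_eq_of_coprime hq hn h.1.2, h.1.1.symm.gcd_eq_one, h.2.symm.gcd_eq_one]
  push_cast
  ring

theorem numPowers_of_coprime_natCard (h : n.Coprime (Nat.card SL(2, F))) :
    (numPowers n F : ℝ) = Nat.card F ^ 3 - Nat.card F := by
  rw [natCard_specialLinearGroup_two_eq_mul hq, Nat.coprime_mul_iff_right,
    Nat.coprime_mul_iff_right] at h
  rw [numPowers_eq_of_coprime hq hn h.1.2, h.1.1.symm.gcd_eq_one, h.2.symm.gcd_eq_one]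
  push_cast
  ring

theorem numPowerClasses_of_dvd_natCard (hn1 : n ≠ 1) (h : n ∣ Nat.card F) :
    (numPowerClasses n F : ℝ) = Nat.card F := by
  rw [numPowerClasses_eq_of_not_coprime hq hn fun h' => hn1 (h'.eq_one_of_dvd h),
    gcd_sub_one_eq_one_of_dvd Nat.card_pos h, gcd_add_one_eq_one_of_dvd h]
  push_cast
  ring

theorem numPowers_of_dvd_natCard (hn1 : n ≠ 1) (h : n ∣ Nat.card F) :
    (numPowers n F : ℝ) = (Nat.card F - 2) * (Nat.card F ^ 2 - 1) := by
  rw [numPowers_eq_of_not_coprime hq hn fun h' => hn1 (h'.eq_one_of_dvd h),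
    gcd_sub_one_eq_one_of_dvd Nat.card_pos h, gcd_add_one_eq_one_of_dvd h]
  push_cast
  ring

theorem numPowerClasses_of_dvd_sub_one (h : n ∣ Nat.card F - 1) :
    (numPowerClasses n F : ℝ) = (n + 1) * (Nat.card F - 1) / (2 * n) + 5 := by
  have hn0 : (n : ℝ) ≠ 0 := by exact_mod_cast hn.pos.ne'
  rw [numPowerClasses_eq_of_coprime hq hn (coprime_of_dvd_sub_one_or_add_one Nat.card_pos (.inl h)),
    Nat.gcd_eq_right h, gcd_add_one_eq_one_of_dvd_sub_one Nat.card_pos hn h]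
  push_cast
  field

theorem numPowerClasses_of_dvd_add_one (h : n ∣ Nat.card F + 1) :
    (numPowerClasses n F : ℝ) = ((n + 1) * (Nat.card F - 3) + 4) / (2 * n) + 5 := by
  have hn0 : (n : ℝ) ≠ 0 := by exact_mod_cast hn.pos.ne'
  rw [numPowerClasses_eq_of_coprime hq hn (coprime_of_dvd_sub_one_or_add_one Nat.card_pos (.inr h)),
    Nat.gcd_eq_right h, gcd_sub_one_eq_one_of_dvd_add_one Nat.card_pos hn h]
  push_cast
  field

theorem numPowers_of_dvd_sub_one_or_add_one (h : n ∣ Nat.card F - 1 ∨ n ∣ Nat.card F + 1) :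
    (numPowers n F : ℝ) = (n + 1) * (Nat.card F ^ 3 - Nat.card F) / (2 * n) := by
  have hn0 : (n : ℝ) ≠ 0 := by exact_mod_cast hn.pos.ne'
  rw [numPowers_eq_of_coprime hq hn (coprime_of_dvd_sub_one_or_add_one Nat.card_pos h)]
  rcases h with h | h
  · rw [Nat.gcd_eq_right h, gcd_add_one_eq_one_of_dvd_sub_one Nat.card_pos hn h]
    push_cast
    field
  · rw [Nat.gcd_eq_right h, gcd_sub_one_eq_one_of_dvd_add_one Nat.card_pos hn h]
    push_cast
    field

theorem numPowers_div_natCard (h : n ∣ Nat.card F - 1 ∨ n ∣ Nat.card F + 1) :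
    (numPowers n F : ℝ) / Nat.card SL(2, F) = (n + 1) / (2 * n) := by
  have hG : (Nat.card SL(2, F) : ℝ) ≠ 0 := by exact_mod_cast Nat.card_pos.ne'
  rw [div_eq_iff hG, numPowers_of_dvd_sub_one_or_add_one hq hn h,
    natCard_specialLinearGroup_two hq]
  ring

theorem abs_numPowerClasses_div_natCard_sub_le (h : n ∣ Nat.card F - 1 ∨ n ∣ Nat.card F + 1) :
    |(numPowerClasses n F : ℝ) / Nat.card (ConjClasses SL(2, F)) - (n + 1) / (2 * n)| ≤
      5 / 2 / (Nat.card F + 4) := by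
  have hn0 : (n : ℝ) ≠ 0 := by exact_mod_cast hn.pos.ne'
  have hq4 : (0 : ℝ) < Nat.card F + 4 := by positivity
  have hinv : 1 - (n : ℝ)⁻¹ ∈ Set.Icc 0 1 :=
    ⟨sub_nonneg.2 (Nat.cast_inv_le_one n), sub_le_self _ (by positivity)⟩
  rw [natCard_conjClasses_specialLinearGroup_two hq, div_sub' hq4.ne', abs_div, abs_of_pos hq4]
  gcongr
  rcases h with h | h
  · have hdiff : (numPowerClasses n F : ℝ) - (Nat.card F + 4) * ((n + 1) / (2 * n)) =
        5 / 2 * (1 - (n : ℝ)⁻¹) := by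
      rw [numPowerClasses_of_dvd_sub_one hq hn h]
      field
    rw [hdiff, abs_of_nonneg (mul_nonneg (by norm_num) hinv.1)]
    linarith [hinv.2]
  · have hdiff : (numPowerClasses n F : ℝ) - (Nat.card F + 4) * ((n + 1) / (2 * n)) =
        3 / 2 * (1 - (n : ℝ)⁻¹) := by
      rw [numPowerClasses_of_dvd_add_one hq hn h]
      field
    rw [hdiff, abs_of_nonneg (mul_nonneg (by norm_num) hinv.1)]
    linarith [hinv.2]

end Cases

theorem theorem8p4_general (n : ℕ) (hn : Odd n) (hn1 : n ≠ 1) :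
    (∀ (F : Type u) [Field F] [Finite F] (q : ℕ), Nat.card F = q → Odd q →
      (Nat.card SL(2, F) : ℝ) = ((q : ℝ) - 1) * (q : ℝ) * ((q : ℝ) + 1) ∧
      (n.Coprime (Nat.card SL(2, F)) →
        (numPowerClasses n F : ℝ) = (q : ℝ) + 4 ∧
        (numPowers n F : ℝ) = (q : ℝ) ^ 3 - (q : ℝ)) ∧
      (n ∣ q →
        (numPowerClasses n F : ℝ) = (q : ℝ) ∧
        (numPowers n F : ℝ) = ((q : ℝ) - 2) * ((q : ℝ) ^ 2 - 1)) ∧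
      (n ∣ q - 1 →
        (numPowerClasses n F : ℝ)
          = ((n : ℝ) + 1) * ((q : ℝ) - 1) / (2 * (n : ℝ)) + 5 ∧
        (numPowers n F : ℝ)
          = ((n : ℝ) + 1) * ((q : ℝ) ^ 3 - (q : ℝ)) / (2 * (n : ℝ))) ∧
      (n ∣ q + 1 →
        (numPowerClasses n F : ℝ)
          = (((n : ℝ) + 1) * ((q : ℝ) - 3) + 4) / (2 * (n : ℝ)) + 5 ∧
        (numPowers n F : ℝ)
          = ((n : ℝ) + 1) * ((q : ℝ) ^ 3 - (q : ℝ)) / (2 * (n : ℝ)))) ∧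
    (∀ ε : ℝ, 0 < ε → ∃ N : ℕ, ∀ (F : Type u) [Field F] [Finite F] (q : ℕ),
      Nat.card F = q → Odd q → (n ∣ q - 1 ∨ n ∣ q + 1) → N ≤ q →
        |(numPowerClasses n F : ℝ)
            / (Nat.card (ConjClasses SL(2, F)) : ℝ) - ((n : ℝ) + 1) / (2 * (n : ℝ))| < ε ∧
        |(numPowers n F : ℝ) / (Nat.card SL(2, F) : ℝ)
          - ((n : ℝ) + 1) / (2 * (n : ℝ))| < ε) := by
  refine ⟨?_, fun ε hε => ?_⟩
  · rintro F _ _ _ rfl hq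
    exact ⟨natCard_specialLinearGroup_two hq,
      fun h => ⟨numPowerClasses_of_coprime_natCard hq hn h, numPowers_of_coprime_natCard hq hn h⟩,
      fun h => ⟨numPowerClasses_of_dvd_natCard hq hn hn1 h, numPowers_of_dvd_natCard hq hn hn1 h⟩,
      fun h => ⟨numPowerClasses_of_dvd_sub_one hq hn h,
        numPowers_of_dvd_sub_one_or_add_one hq hn (.inl h)⟩,
      fun h => ⟨numPowerClasses_of_dvd_add_one hq hn h,
        numPowers_of_dvd_sub_one_or_add_one hq hn (.inr h)⟩⟩
  · obtain ⟨N, hN⟩ := exists_nat_gt (5 / 2 / ε)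
    refine ⟨N, ?_⟩
    rintro F _ _ _ rfl hq h hNq
    have hlt : 5 / 2 / ((Nat.card F : ℝ) + 4) < ε := by
      rw [div_lt_comm₀ (by positivity) hε]
      have : (N : ℝ) ≤ Nat.card F := by exact_mod_cast hNq
      linarith
    refine ⟨(abs_numPowerClasses_div_natCard_sub_le hq hn h).trans_lt hlt, ?_⟩
    rwa [numPowers_div_natCard hq hn h, sub_self, abs_zero]

theorem theorem8p4 (n : ℕ) (hn : n.Prime) (hn3 : 3 ≤ n) :
    -- the exact formulas, for every finite field `F` with an odd number `q` of elements
    (∀ (F : Type u) [Field F] [Finite F] (q : ℕ), Nat.card F = q → Odd q →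
      (Nat.card (Matrix.SpecialLinearGroup (Fin 2) F) : ℝ)
          = ((q : ℝ) - 1) * (q : ℝ) * ((q : ℝ) + 1) ∧
      (¬ n ∣ Nat.card (Matrix.SpecialLinearGroup (Fin 2) F) →
        (numPowerClasses n F : ℝ) = (q : ℝ) + 4 ∧
        (numPowers n F : ℝ) = (q : ℝ) ^ 3 - (q : ℝ)) ∧
      (n ∣ q →
        (numPowerClasses n F : ℝ) = (q : ℝ) ∧
        (numPowers n F : ℝ) = ((q : ℝ) - 2) * ((q : ℝ) ^ 2 - 1)) ∧
      (n ∣ q - 1 →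
        (numPowerClasses n F : ℝ)
          = ((n : ℝ) + 1) * ((q : ℝ) - 1) / (2 * (n : ℝ)) + 5 ∧
        (numPowers n F : ℝ)
          = ((n : ℝ) + 1) * ((q : ℝ) ^ 3 - (q : ℝ)) / (2 * (n : ℝ))) ∧
      (n ∣ q + 1 →
        (numPowerClasses n F : ℝ)
          = (((n : ℝ) + 1) * ((q : ℝ) - 3) + 4) / (2 * (n : ℝ)) + 5 ∧
        (numPowers n F : ℝ)
          = ((n : ℝ) + 1) * ((q : ℝ) ^ 3 - (q : ℝ)) / (2 * (n : ℝ)))) ∧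
    -- both proportions tend to `(n + 1) / (2 n)` as `q → ∞` with `n ∤ q`, `n ∣ |SL₂(F)|`
    (∀ ε : ℝ, 0 < ε → ∃ N : ℕ, ∀ (F : Type u) [Field F] [Finite F] (q : ℕ),
      Nat.card F = q → Odd q → ¬ n ∣ q →
      n ∣ Nat.card (Matrix.SpecialLinearGroup (Fin 2) F) → N ≤ q →
        |(numPowerClasses n F : ℝ)
            / (Nat.card (ConjClasses (Matrix.SpecialLinearGroup (Fin 2) F)) : ℝ)
          - ((n : ℝ) + 1) / (2 * (n : ℝ))| < ε ∧
        |(numPowers n F : ℝ) / (Nat.card (Matrix.SpecialLinearGroup (Fin 2) F) : ℝ)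
          - ((n : ℝ) + 1) / (2 * (n : ℝ))| < ε) := by
  obtain ⟨hformulas, hlimits⟩ := theorem8p4_general n (hn.odd_of_ne_two (by omega)) hn.ne_one
  refine ⟨fun F _ _ q hF hq => (hformulas F q hF hq).imp_right
    (And.imp_left fun h hdvd => h (hn.coprime_iff_not_dvd.2 hdvd)),
    fun ε hε => (hlimits ε hε).imp ?_⟩
  rintro N h F _ _ _ rfl hq hnq hdvd
  exact h F _ rfl hq (dvd_sub_one_or_add_one_of_dvd_natCard hq hn hdvd hnq)
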